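/- For $z\in\mathbb{C}$ and $n\in\mathbb{N}_0$ let $(z)_n=\prod_{i=1}^n(z+i-1)$, and for $|z|<1$ and lower parameters $b_j\notin-\mathbb{N}_0$ let $${}_pF_q\left(\begin{array}{c}a_1,\dots,a_p\\ b_1,\dots,b_q\end{array};z\right)=\sum_{n=0}^\infty\frac{(a_1)_n\cdots(a_p)_n}{(b_1)_n\cdots(b_q)_n}\frac{z^n}{n!}$$ (for ${}_2F_1$ with a first parameter in $-\mathbb{N}_0$ the series terminates and any $z\in\mathbb{C}$ is allowed). Let $$P_n^{(\gamma,\beta)}(z)=\frac{(\gamma+1)_n}{n!}\,{}_2F_1\left(\begin{array}{c}-n,\;n+\gamma+\beta+1\\ \gamma+1\end{array};\frac{1-z}{2}\right)$$ be the Jacobi polynomials. **Theorem.** Let $\alpha\in\mathbb{C}$, let $\beta,\gamma>-1$ be real numbers such that $\beta+\gamma+1\ne0$ if $\beta,\gamma\in(-1,0)$, let $\rho\in\mathbb{C}$ with $|\rho|<1$, and let $x\in[-1,1]$. Put $R=\sqrt{1+\rho^2-2\rho x}$ (the square root and all powers below are principal values). (i) If $\alpha+\beta+1\notin-\mathbb{N}_0$,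 then $$\frac{2^{\alpha+\beta}}{R\,(1+R-\rho)^\alpha(1+R+\rho)^\beta}=\sum_{k=0}^\infty c_k(\alpha)\,\rho^k P_k^{(\gamma,\beta)}(x),$$ where the series converges absolutely and $$c_k(\alpha)=\frac{1}{\gamma+\beta+1}\,\frac{(2k+\gamma+\beta+1)\,(\gamma+\beta+1)_k\left(\frac{\alpha+\beta+1}{2}\right)_k\left(\frac{\alpha+\beta+2}{2}\right)_k}{(\alpha+\beta+1)_k\left(\frac{\gamma+\beta+2}{2}\right)_k\left(\frac{\gamma+\beta+3}{2}\right)_k}\;{}_3F_2\left(\begin{array}{c}\beta+k+1,\;\alpha+\beta+2k+1,\;\alpha-\gamma\\ \alpha+\beta+k+1,\;\gamma+\beta+2k+2\end{array};\rho\right).$$ (ii) If $\alpha+\beta+1\in-\mathbb{N}_0$ (where the formula for $c_k(\alpha)$ has vanishing denominators), then for every $k$ the limit $c_k(\alpha):=\lim_{\alpha'\to\alpha,\ \alpha'\neq\alpha}c_k(\alpha')$ exists, and with these coefficients the same expansion holds and converges absolutely. -/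

import Mathlib

open Filter Topology Set

noncomputable section

/-- The Pochhammer symbol (rising factorial) `(z)_n = z (z + 1) ⋯ (z + n - 1)`. -/
abbrev poch (z : ℂ) (n : ℕ) : ℂ := (ascPochhammer ℂ n).eval z

/-- The generalized hypergeometric series with upper parameters `a` and lower parameters `b`,
`∑ (a₁)_n ⋯ (a_p)_n / ((b₁)_n ⋯ (b_q)_n) * z ^ n / n!`. -/
def hyperPFQ (a b : List ℂ) (z : ℂ) : ℂ :=
  ∑' n : ℕ, (a.map fun c => poch c n).prod / (b.map fun c => poch c n).prod *
    (z ^ n / (n.factorial : ℂ))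

/-- The Jacobi polynomial `P_n^{(a,b)}(z)`, as a terminating Gauss hypergeometric series. -/
def jacobiP (a b : ℂ) (n : ℕ) (z : ℂ) : ℂ :=
  poch (a + 1) n / (n.factorial : ℂ) *
    ordinaryHypergeometric (-(n : ℂ)) ((n : ℂ) + a + b + 1) (a + 1) ((1 - z) / 2)

/-- `R = √(1 + ρ² - 2ρx)`, with the principal branch of the square root. -/
def genR (ρ x : ℂ) : ℂ := (1 + ρ ^ 2 - 2 * ρ * x) ^ (1 / 2 : ℂ)

/-- The algebraic generating function of the Jacobi polynomials
(all powers are principal values). -/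
def jacobiGen (α β ρ x : ℂ) : ℂ :=
  2 ^ (α + β) / (genR ρ x * (1 + genR ρ x - ρ) ^ α * (1 + genR ρ x + ρ) ^ β)

/-- The coefficient of `ρ ^ k * P_k^{(γ,β)}(x)` in the expansion. -/
def expansionCoeff (α β γ ρ : ℂ) (k : ℕ) : ℂ :=
  1 / (γ + β + 1) *
    ((2 * (k : ℂ) + γ + β + 1) * poch (γ + β + 1) k *
        poch ((α + β + 1) / 2) k * poch ((α + β + 2) / 2) k /
      (poch (α + β + 1) k * poch ((γ + β + 2) / 2) k * poch ((γ + β + 3) / 2) k)) *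
    hyperPFQ [β + (k : ℂ) + 1, α + β + 2 * (k : ℂ) + 1, α - γ]
      [α + β + (k : ℂ) + 1, γ + β + 2 * (k : ℂ) + 2] ρ

end

open scoped NNReal

/-! The left-hand side is the generating function `∑ P_n^{(α,β)}(x) ρ^n`. Expanding each
`P_n^{(α,β)}` in the polynomials `P_k^{(γ,β)}` and collecting the terms with the same `k` gives the
theorem, since the inner sum over `j = n - k` is the stated ₃F₂ coefficient.

The generating function comes from Lagrange inversion: `P_n` is the `n`-th Taylor coefficient of `f
φ^n`, so a geometric series under a contour integral leaves a residue at the small root of a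
quadratic with discriminant `R²` (`hasSum_jacobiPoly_root`). This holds near `ρ = 0` and extends to
the disc by holomorphy (`hasSum_jacobiPoly`).

The connection formula (`jacobiPoly_connection`) reduces, power by power, to the terminating sum
`sum_wellPoised`. It changes the second parameter; the symmetry `x ↦ -x`, read off the generating
function, turns this into a change of the first.

Connection coefficients grow polynomially in `k + j`, uniformly for bounded `α`
(`norm_connCoeff_le`). This justifies reordering the double series. They are also polynomial in `α`,
so the inner sums are continuous in `α`, and part (ii) follows because the poles of the closed
formula for `c_k` are removable. -/

/-! ### Pochhammer symbols and a terminating summation -/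

theorem poch_zero (z : ℂ) : poch z 0 = 1 := by simp [poch]

theorem poch_succ (z : ℂ) (n : ℕ) : poch z (n + 1) = poch z n * (z + n) :=
  ascPochhammer_succ_eval n z

theorem poch_add (z : ℂ) (m n : ℕ) : poch z (m + n) = poch z m * poch (z + m) n := by
  induction n with
  | zero => simp [poch_zero]
  | succ n ih => rw [← add_assoc, poch_succ, ih, poch_succ]; push_cast; ring

theorem poch_one (z : ℂ) : poch z 1 = z := by simp [poch]

theorem poch_succ_left (z : ℂ) (n : ℕ) : poch z (n + 1) = z * poch (z + 1) n := by
  rw [add_comm n 1, poch_add, poch_one]; simp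

theorem poch_ne_zero {z : ℂ} (n : ℕ) (h : ∀ i : ℕ, z + i ≠ 0) : poch z n ≠ 0 := by
  induction n with
  | zero => simp [poch_zero]
  | succ n ih => rw [poch_succ]; exact mul_ne_zero ih (h n)

/-- A terminating very-well-poised sum. -/
theorem sum_wellPoised (a b : ℂ) (ha : ∀ i : ℕ, a + i ≠ 0) (N : ℕ) :
    ∑ j ∈ Finset.range (N + 1), (-1) ^ (N + j) * (N.choose j : ℂ) *
      ((a + 2 * j) / poch (a + j) (N + 1)) * poch (b - a - N) (N - j) * poch b j = 1 := by
  have ha' (i k : ℕ) : a + i + k ≠ 0 := by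
    have := ha (i + k); push_cast at this; rwa [← add_assoc] at this
  induction N with
  | zero =>
    have := ha 0
    simp only [Nat.cast_zero, add_zero] at this
    simp [poch_zero, poch_one, this]
  | succ N ih =>
    -- Wilf–Zeilberger companion: the increment of the summand in `N` is the difference of `G` in
    -- `j`. Both ends of the telescoped sum vanish, so the sum keeps its value from `N = 0`.
    let G : ℕ → ℂ
      | 0 => 0
      | j + 1 => (-1) ^ (N + j + 1) * (N.choose j : ℂ) * poch (b - a - N) (N - j) *
          poch b (j + 1) / poch (a + (j + 1 : ℕ)) (N + 1)
    have key : ∀ j ∈ Finset.range (N + 2),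
        (-1) ^ (N + 1 + j) * ((N + 1).choose j : ℂ) *
          ((a + 2 * j) / poch (a + j) (N + 1 + 1)) * poch (b - a - (N + 1 : ℕ)) (N + 1 - j) *
          poch b j -
        (-1) ^ (N + j) * (N.choose j : ℂ) *
          ((a + 2 * j) / poch (a + j) (N + 1)) * poch (b - a - N) (N - j) * poch b j =
        G (j + 1) - G j := by
      intro j hj
      have hp (i k : ℕ) : poch (a + i) k ≠ 0 := poch_ne_zero _ (ha' i)
      rcases Nat.lt_or_ge N j with h | h
      · obtain rfl : j = N + 1 := by have := Finset.mem_range.1 hj; omega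
        have h1 := hp (N + 1) (N + 1)
        have h2 := ha' (N + 1) (N + 1)
        have e : poch (a + (N + 1 : ℕ)) (N + 1 + 1) = _ := poch_succ _ _
        have h3 : a + 2 * ((N + 1 : ℕ) : ℂ) ≠ 0 := by convert h2 using 1; ring
        have e2 : a + (N + 1 : ℕ) + (N + 1 : ℕ) = a + 2 * ((N + 1 : ℕ) : ℂ) := by ring
        rw [e, e2]
        simp only [G, Nat.choose_succ_self, Nat.choose_self, Nat.sub_self, poch_zero]
        field_simp
        push_cast
        ring_nf
      · obtain ⟨l, rfl⟩ := Nat.exists_eq_add_of_le h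
        have e1 : poch (b - a - (j + l + 1 : ℕ)) (j + l + 1 - j) =
            (b - a - (j + l + 1 : ℕ)) * poch (b - a - (j + l : ℕ)) l := by
          rw [show j + l + 1 - j = l + 1 by omega, poch_succ_left]; congr 2; push_cast; ring
        have e2 : poch (a + j) (j + l + 1 + 1) = poch (a + j) (j + l + 1) * (a + j + (j + l + 1 : ℕ)) :=
          poch_succ _ _
        have e3 : poch (a + j) (j + l + 1 + 1) = (a + j) * poch (a + (j + 1 : ℕ)) (j + l + 1) := by
          rw [poch_succ_left]; push_cast; ring_nf
        have h1 := hp j (j + l + 1)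
        have h2 := hp (j + 1) (j + l + 1)
        have h3 := ha' j (j + l + 1)
        have h4 := ha j
        have e4 : poch (a + (j + 1 : ℕ)) (j + l + 1) =
            poch (a + j) (j + l + 1) * (a + j + (j + l + 1 : ℕ)) / (a + j) := by
          rw [← e2, e3]; field_simp
        rcases j with _ | i
        · simp only [G, e1, e2, e4]
          simp only [Nat.zero_add, Nat.choose_zero_right, Nat.sub_zero, poch_zero, poch_one] at *
          field_simp
          push_cast
          ring
        · have e5 : poch (b - a - (i + 1 + l : ℕ)) (i + 1 + l - i) =
              poch (b - a - (i + 1 + l : ℕ)) l * (b - a - (i + 1)) := by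
            rw [show i + 1 + l - i = l + 1 by omega, poch_succ]; push_cast; ring
          have e6 := Nat.choose_succ_right_eq (i + 1 + l) i
          have e7 : (((i + 1 + l).choose i : ℕ) : ℂ) =
              ((i + 1 + l).choose (i + 1) : ℂ) * (i + 1) / (l + 1) := by
            rw [show i + 1 + l - i = l + 1 by omega] at e6
            have : (l : ℂ) + 1 ≠ 0 := by exact_mod_cast l.succ_ne_zero
            rw [eq_div_iff this]; exact_mod_cast e6.symm
          have e8 : (((i + 1 + l + 1).choose (i + 1) : ℕ) : ℂ) =
              ((i + 1 + l).choose (i + 1) : ℂ) * (i + 1) / (l + 1) +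
                ((i + 1 + l).choose (i + 1) : ℂ) := by
            rw [Nat.choose_succ_succ, Nat.cast_add, e7]
          have : (l : ℂ) + 1 ≠ 0 := by exact_mod_cast l.succ_ne_zero
          simp only [G, e1, e2, e4, e5, e7, e8, Nat.add_sub_cancel_left, poch_succ b (i + 1)]
          have s1 : (-1 : ℂ) ^ (i + 1 + l + 1 + (i + 1)) = - (-1) ^ (i + 1 + l + (i + 1)) := by ring
          have s2 : (-1 : ℂ) ^ (i + 1 + l + (i + 1) + 1) = - (-1) ^ (i + 1 + l + (i + 1)) := by ring
          have s3 : (-1 : ℂ) ^ (i + 1 + l + i + 1) = (-1) ^ (i + 1 + l + (i + 1)) := by ring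
          rw [s1, s2, s3]
          field_simp
          push_cast
          ring
    have h := Finset.sum_congr rfl key
    rw [Finset.sum_range_sub, Finset.sum_sub_distrib, 
      (Finset.sum_range_succ (fun j : ℕ => (-1 : ℂ) ^ (N + j) * (N.choose j : ℂ) *
          ((a + 2 * j) / poch (a + j) (N + 1)) * poch (b - a - N) (N - j) * poch b j) (N + 1)), ih] at h
    simp only [G, Nat.choose_succ_self] at h
    simp only [Nat.cast_zero, mul_zero, zero_mul, add_zero, zero_div, sub_zero] at h
    exact sub_eq_zero.1 h

/-! ### The connection formula -/

noncomputable section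

/-- The Jacobi polynomial as a polynomial in all its parameters, in powers of `t = (x - 1) / 2`. -/
def jacobiPoly (a b : ℂ) (n : ℕ) (t : ℂ) : ℂ :=
  ∑ m ∈ Finset.range (n + 1), poch (n + a + b + 1) m / (m.factorial : ℂ) *
    (poch (a + m + 1) (n - m) / ((n - m).factorial : ℂ)) * t ^ m

/-- The coefficient of `P_k^{(γ,β)}` in the expansion of `P_{k+j}^{(α,β)}`. -/
def connCoeff (α β γ : ℂ) (k j : ℕ) : ℂ :=
  poch (β + k + 1) j * poch (α - γ) j * poch (α + β + k + j + 1) k /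
    (poch (γ + β + k + 1) k * poch (γ + β + 2 * k + 2) j * (j.factorial : ℂ))

end

/-- Compares coefficients of `s^m` for degree `n = m + j + l`: the contribution of `k = m + j` is
the target coefficient times the `j`-th summand of `sum_wellPoised` with `a = γ + β + 1 + 2m`, `b =
n + β + α + 1 + m`, `N = j + l`. There `b - a - N = α - γ`. -/
theorem connCoeff_mul (α β γ : ℂ) (hc : ∀ i : ℕ, γ + β + 1 + i ≠ 0) (m j l : ℕ) :
    connCoeff α β γ (m + j) l * ((-1) ^ (m + j) *
      (poch ((m + j : ℕ) + β + γ + 1) m / (m.factorial : ℂ) *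
        (poch (β + m + 1) j / (j.factorial : ℂ)))) =
    (-1) ^ (m + (j + l)) * (poch ((m + (j + l) : ℕ) + β + α + 1) m / (m.factorial : ℂ) *
        (poch (β + m + 1) (j + l) / ((j + l).factorial : ℂ))) *
      ((-1) ^ (j + l + j) * ((j + l).choose j : ℂ) *
      ((γ + β + 1 + 2 * m + 2 * j) / poch (γ + β + 1 + 2 * m + j) (j + l + 1)) *
      poch ((m + (j + l) : ℕ) + β + α + 1 + m - (γ + β + 1 + 2 * m) - (j + l : ℕ)) (j + l - j) *
      poch ((m + (j + l) : ℕ) + β + α + 1 + m) j) := by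
  have hp (i k : ℕ) : poch (γ + β + 1 + i) k ≠ 0 := poch_ne_zero _ fun q => by
    have := hc (i + q); push_cast at this; rwa [← add_assoc] at this
  have f1 : (m.factorial : ℂ) ≠ 0 := by exact_mod_cast m.factorial_ne_zero
  have f2 : (j.factorial : ℂ) ≠ 0 := by exact_mod_cast j.factorial_ne_zero
  have f3 : (l.factorial : ℂ) ≠ 0 := by exact_mod_cast l.factorial_ne_zero
  have f4 : ((j + l).factorial : ℂ) ≠ 0 := by exact_mod_cast (j + l).factorial_ne_zero
  have e1 : (((j + l).choose j : ℕ) : ℂ) =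
      ((j + l).factorial : ℂ) / (j.factorial * l.factorial) := by
    rw [eq_div_iff (mul_ne_zero f2 f3)]
    have := Nat.add_choose_mul_factorial_mul_factorial j l
    rw [← Nat.choose_symm_add] at this
    rw [← mul_assoc]; exact_mod_cast this
  have e2 : poch (β + m + 1) (j + l) = poch (β + m + 1) j * poch (β + (m + j : ℕ) + 1) l := by
    rw [poch_add]; congr 2; push_cast; ring
  have e3 : poch (α + β + (m + j : ℕ) + l + 1) (m + j) =
      poch ((m + (j + l) : ℕ) + β + α + 1) m * poch ((m + (j + l) : ℕ) + β + α + 1 + m) j := by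
    rw [poch_add]; congr 2 <;> (push_cast; ring)
  have e4 : poch ((m + (j + l) : ℕ) + β + α + 1 + m - (γ + β + 1 + 2 * m) - (j + l : ℕ)) (j + l - j)
      = poch (α - γ) l := by
    rw [Nat.add_sub_cancel_left]; congr 1; push_cast; ring
  set c := γ + β + 1 with hcd
  have d1 : poch (γ + β + (m + j : ℕ) + 1) (m + j) = poch (c + (m + j : ℕ)) (m + j) := by
    congr 1; rw [hcd]; ring
  have d2 : poch (γ + β + 2 * (m + j : ℕ) + 2) l = poch (c + (2 * (m + j) + 1 : ℕ)) l := by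
    congr 1; rw [hcd]; push_cast; ring
  have d3 : poch ((m + j : ℕ) + β + γ + 1) m = poch (c + (m + j : ℕ)) m := by
    congr 1; rw [hcd]; ring
  have d4 : poch (c + 2 * m + j) (j + l + 1) = poch (c + (2 * m + j : ℕ)) (j + l + 1) := by
    congr 1; push_cast; ring
  have d5 : c + 2 * m + 2 * j = c + (2 * (m + j) : ℕ) := by push_cast; ring
  have d6 : poch (c + (m + j : ℕ)) m * poch (c + (2 * m + j : ℕ)) (j + l + 1) =
      poch (c + (m + j : ℕ)) (m + j) *
        ((c + (2 * (m + j) : ℕ)) * poch (c + (2 * (m + j) + 1 : ℕ)) l) := by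
    have h1 := poch_add (c + (m + j : ℕ)) m (j + l + 1)
    have h2 := poch_add (c + (m + j : ℕ)) (m + j) (l + 1)
    rw [poch_succ_left] at h2
    rw [show m + (j + l + 1) = m + j + (l + 1) by ring, h2] at h1
    convert h1.symm using 2
    · congr 1; push_cast; ring
    · congr 1
      · push_cast; ring
      · congr 1; push_cast; ring
  have n1 := hp (m + j) (m + j)
  have n2 := hp (2 * (m + j) + 1) l
  have n3 := hp (2 * m + j) (j + l + 1)
  have n4 := hc (2 * (m + j))
  have d7 : (c + (2 * (m + j) : ℕ)) / poch (c + (2 * m + j : ℕ)) (j + l + 1) =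
      poch (c + (m + j : ℕ)) m /
        (poch (c + (m + j : ℕ)) (m + j) * poch (c + (2 * (m + j) + 1 : ℕ)) l) := by
    rw [div_eq_div_iff n3 (mul_ne_zero n1 n2), d6]; ring
  have s : (-1 : ℂ) ^ (m + (j + l)) * (-1) ^ (j + l + j) = (-1) ^ (m + j) := by
    rw [← pow_add, show m + (j + l) + (j + l + j) = m + j + 2 * (j + l) by ring, pow_add, pow_mul]
    simp
  rw [connCoeff, e1, e2, e3, e4, d1, d2, d3, d4, d5, d7, ← s]
  field_simp

theorem jacobiPoly_connection (α β γ : ℂ) (hc : ∀ i : ℕ, γ + β + 1 + i ≠ 0) (n : ℕ) (s : ℂ) :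
    (-1) ^ n * jacobiPoly β α n s =
      ∑ k ∈ Finset.range (n + 1), connCoeff α β γ k (n - k) * ((-1) ^ k * jacobiPoly β γ k s) := by
  simp only [jacobiPoly, Finset.mul_sum]
  rw [Finset.sum_comm' (t' := Finset.range (n + 1)) (s' := fun m => Finset.Ico m (n + 1))
    (by intro x y; simp only [Finset.mem_range, Finset.mem_Ico]; omega)]
  refine Finset.sum_congr rfl fun m hm => ?_
  obtain ⟨N, rfl⟩ := Nat.exists_eq_add_of_le (Nat.lt_succ_iff.1 (Finset.mem_range.1 hm))
  rw [Finset.sum_Ico_eq_sum_range, show m + N + 1 - m = N + 1 by omega]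
  have h := sum_wellPoised (γ + β + 1 + 2 * m) ((m + N : ℕ) + β + α + 1 + m)
    (fun i => by have := hc (2 * m + i); push_cast at this; rwa [← add_assoc] at this) N
  rw [Nat.add_sub_cancel_left]
  calc _ = (-1) ^ (m + N) * (poch ((m + N : ℕ) + β + α + 1) m / (m.factorial : ℂ) *
        (poch (β + m + 1) N / (N.factorial : ℂ))) * s ^ m * 1 := by ring
    _ = _ := by
      refine (congrArg _ h.symm).trans ?_
      rw [Finset.mul_sum]
      refine Finset.sum_congr rfl fun j hj => ?_
      obtain ⟨l, rfl⟩ := Nat.exists_eq_add_of_le (Nat.lt_succ_iff.1 (Finset.mem_range.1 hj))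
      rw [show m + (j + l) - (m + j) = l by omega, show m + j - m = j by omega]
      linear_combination (-s ^ m) * connCoeff_mul α β γ hc m j l

/-! ### Power series and contour integrals -/

theorem hasFPowerSeriesOnBall_of_hasSum {c : ℕ → ℂ} {f : ℂ → ℂ} {r : ℝ≥0} (hr : 0 < r)
    (h : ∀ z : ℂ, ‖z‖ < r → HasSum (fun n => c n * z ^ n) (f z)) :
    HasFPowerSeriesOnBall f (FormalMultilinearSeries.ofScalars ℂ c) 0 r where
  r_le := by
    refine ENNReal.le_of_forall_nnreal_lt fun s hs => ?_
    refine FormalMultilinearSeries.le_radius_of_tendsto _ (l := 0) ?_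
    have h1 := (h (s : ℂ) (by simpa using hs)).summable.tendsto_atTop_zero.norm
    simpa [FormalMultilinearSeries.ofScalars_norm] using h1
  r_pos := by simpa using hr
  hasSum := fun {y} hy => by
    have := h y (by simpa using hy)
    simpa [FormalMultilinearSeries.ofScalars_apply_eq, mul_comm] using this

theorem differentiableOn_of_hasSum {c : ℕ → ℂ} {f : ℂ → ℂ} {r : ℝ≥0} (hr : 0 < r)
    (h : ∀ z : ℂ, ‖z‖ < r → HasSum (fun n => c n * z ^ n) (f z)) :
    DifferentiableOn ℂ f (Metric.ball 0 r) := by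
  have := (hasFPowerSeriesOnBall_of_hasSum hr h).differentiableOn
  rwa [Metric.eball_coe] at this

theorem circleIntegral_div_pow_of_hasSum {c : ℕ → ℂ} {f : ℂ → ℂ} {r s : ℝ≥0} (hs : 0 < s)
    (hsr : s < r) (h : ∀ z : ℂ, ‖z‖ < r → HasSum (fun n => c n * z ^ n) (f z)) (n : ℕ) :
    ∮ z in C(0, s), f z / z ^ (n + 1) = 2 * Real.pi * Complex.I * c n := by
  have h1 := hasFPowerSeriesOnBall_of_hasSum (hs.trans hsr) h
  have h2 := ((differentiableOn_of_hasSum (hs.trans hsr) h).mono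
    (Metric.closedBall_subset_ball (NNReal.coe_lt_coe.2 hsr))).hasFPowerSeriesOnBall hs
  have h3 := h1.hasFPowerSeriesAt.eq_formalMultilinearSeries h2.hasFPowerSeriesAt
  have h4 := congrArg (fun p : FormalMultilinearSeries ℂ ℂ ℂ => p n fun _ => 1) h3
  simp only [cauchyPowerSeries_apply, FormalMultilinearSeries.ofScalars_apply_eq] at h4
  simp only [one_pow, smul_eq_mul, mul_one, sub_zero, one_div] at h4
  rw [h4, mul_inv_cancel_left₀ Complex.two_pi_I_ne_zero]
  congr 1; ext z; rw [inv_pow, pow_succ]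
  rw [div_eq_mul_inv, mul_inv]; ring

/-- Power series coefficients found near the centre are valid on every ball of holomorphy. -/
theorem hasSum_of_differentiableOn_of_hasSum {c : ℕ → ℂ} {f : ℂ → ℂ} {r : ℝ}
    (hf : DifferentiableOn ℂ f (Metric.ball 0 r))
    (h : ∀ᶠ z in 𝓝 (0 : ℂ), HasSum (fun n => c n * z ^ n) (f z)) {z : ℂ} (hz : ‖z‖ < r) :
    HasSum (fun n => c n * z ^ n) (f z) := by
  obtain ⟨ε, hε, hε'⟩ := Metric.eventually_nhds_iff.1 h
  lift ε to ℝ≥0 using hε.le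
  obtain ⟨s, hs, hsr⟩ := exists_between hz
  have hs0 : 0 < s := (norm_nonneg z).trans_lt hs
  lift s to ℝ≥0 using hs0.le
  have h1 := hasFPowerSeriesOnBall_of_hasSum (f := f) (c := c) (NNReal.coe_pos.1 hε)
    fun z hz => hε' (by simpa using hz)
  have h2 := (hf.mono (Metric.closedBall_subset_ball hsr)).hasFPowerSeriesOnBall hs0
  rw [← h1.hasFPowerSeriesAt.eq_formalMultilinearSeries h2.hasFPowerSeriesAt] at h2
  have := h2.hasSum (y := z) (by simpa using hs)
  simpa [FormalMultilinearSeries.ofScalars_apply_eq, mul_comm] using this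

theorem coeff_unique_of_hasSum {c d : ℕ → ℂ} {f : ℂ → ℂ}
    (hc : ∀ z : ℂ, ‖z‖ < 1 → HasSum (fun n => c n * z ^ n) (f z))
    (hd : ∀ z : ℂ, ‖z‖ < 1 → HasSum (fun n => d n * z ^ n) (f z)) : c = d :=
  FormalMultilinearSeries.ofScalars_series_injective ℂ ℂ
    ((hasFPowerSeriesOnBall_of_hasSum (r := 1) one_pos
      (by simpa using hc)).hasFPowerSeriesAt.eq_formalMultilinearSeries
    (hasFPowerSeriesOnBall_of_hasSum (r := 1) one_pos (by simpa using hd)).hasFPowerSeriesAt)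

/-- Since `|ρ φ / z| ≤ q < 1` on the circle, `f / (z - ρ φ)` expands into a uniformly convergent
geometric series, which may be integrated termwise. -/
theorem hasSum_circleIntegral_geometric {f φ : ℂ → ℂ} {r q : ℝ} (hr : 0 < r) (hq : q < 1)
    (hf : ContinuousOn f (Metric.sphere 0 r)) (hφ : ContinuousOn φ (Metric.sphere 0 r)) {ρ : ℂ}
    (h : ∀ z ∈ Metric.sphere (0 : ℂ) r, ‖ρ * φ z / z‖ ≤ q) :
    HasSum (fun n => (∮ z in C(0, r), f z * φ z ^ n / z ^ (n + 1)) * ρ ^ n)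
      (∮ z in C(0, r), f z / (z - ρ * φ z)) := by
  have hz0 : ∀ z ∈ Metric.sphere (0 : ℂ) r, z ≠ 0 := fun z hz h0 => by
    simp [h0] at hz; exact hr.ne hz
  have hq0 : 0 ≤ q := (norm_nonneg _).trans (h r (by simp [hr.le]))
  have hfz : ContinuousOn (fun z => f z / z) (Metric.sphere 0 r) := hf.div continuousOn_id hz0
  have hg : ContinuousOn (fun z => ρ * φ z / z) (Metric.sphere 0 r) :=
    (hφ.const_mul ρ).div continuousOn_id hz0
  obtain ⟨M, hM⟩ := (isCompact_sphere (0 : ℂ) r).exists_bound_of_continuousOn hfz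
  have hsum : Summable fun n : ℕ => M * q ^ n := (summable_geometric_of_lt_one hq0 hq).mul_left M
  have hu := tendstoUniformlyOn_tsum (f := fun n z => f z / z * (ρ * φ z / z) ^ n) hsum
    (s := Metric.sphere 0 r) fun n z hz => by
      rw [norm_mul, norm_pow]
      have h1 := hM z hz
      have h2 := h z hz
      have := (norm_nonneg _).trans h1
      gcongr
  have ht := hu.tendsto_circleIntegral_of_continuousOn hr.le (Eventually.of_forall fun s => by
    exact continuousOn_finsetSum _ fun n _ => hfz.mul (hg.pow n))
  have e1 : (∮ z in C(0, r), ∑' n : ℕ, f z / z * (ρ * φ z / z) ^ n) =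
      ∮ z in C(0, r), f z / (z - ρ * φ z) := by
    refine circleIntegral.integral_congr hr.le fun z hz => ?_
    have h1 := hz0 z hz
    have h2 := (h z hz).trans_lt hq
    have h3 : z - ρ * φ z ≠ 0 := fun h0 => by
      rw [← sub_eq_zero.1 h0, div_self h1, norm_one] at h2
      exact lt_irrefl _ h2
    rw [tsum_mul_left, tsum_geometric_of_norm_lt_one h2, ← div_eq_mul_inv, div_div]
    congr 1; field_simp
  rw [e1] at ht
  refine ht.congr fun s => ?_
  rw [circleIntegral.integral_fun_sum fun n _ =>
    show CircleIntegrable (fun z => f z / z * (ρ * φ z / z) ^ n) 0 r from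
      (hfz.mul (hg.pow n)).circleIntegrable hr.le]
  refine Finset.sum_congr rfl fun n _ => ?_
  beta_reduce
  rw [mul_comm, ← circleIntegral.integral_const_mul]
  refine circleIntegral.integral_congr hr.le fun z hz => ?_
  have h1 := hz0 z hz
  rw [div_pow, mul_pow, pow_succ]
  field_simp

/-! ### Jacobi polynomials as Taylor coefficients -/

theorem poch_neg (z : ℂ) (n : ℕ) : poch (-z) n = (-1) ^ n * poch (z - n + 1) n := by
  rw [poch, ascPochhammer_eval_neg_eq_descPochhammer, descPochhammer_eval_eq_ascPochhammer]

theorem hasSum_one_add_cpow (a : ℂ) {z : ℂ} (hz : ‖z‖ < 1) :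
    HasSum (fun n : ℕ => poch (a - n + 1) n / (n.factorial : ℂ) * z ^ n) ((1 + z) ^ a) := by
  have := (Complex.one_add_cpow_hasFPowerSeriesOnBall_zero (a := a)).hasSum (y := z)
    (by simpa [← ofReal_norm] using hz)
  simp only [binomialSeries_apply, Ring.choose_eq_smul,
    Polynomial.descPochhammer_smeval_eq_ascPochhammer, Polynomial.ascPochhammer_smeval_cast,
    Polynomial.ascPochhammer_smeval_eq_eval, zero_add] at this
  refine (congrArg (HasSum · _) (funext fun n => ?_)).mpr this
  simp [div_eq_inv_mul]

theorem hasSum_one_sub_cpow_neg (a t : ℂ) {z : ℂ} (hz : ‖t * z‖ < 1) :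
    HasSum (fun n : ℕ => poch a n / (n.factorial : ℂ) * t ^ n * z ^ n) ((1 - t * z) ^ (-a)) := by
  have := hasSum_one_add_cpow (-a) (z := -(t * z)) (by simpa using hz)
  convert this using 2 with n
  swap; · ring
  have h := poch_neg (-a) n
  rw [neg_neg] at h
  rw [h, show -(t * z) = (-1) * t * z by ring, mul_pow, mul_pow]; ring

/-- Cauchy product of two binomial series. The function itself depends on `n`, and only its `n`-th
coefficient is a Jacobi polynomial. -/
theorem jacobiPoly_hasSum (a b t : ℂ) (ht : ‖t‖ ≤ 1) (n : ℕ) :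
    ∃ c : ℕ → ℂ, c n = jacobiPoly a b n t ∧ ∀ z : ℂ, ‖z‖ < 1 →
      HasSum (fun k => c k * z ^ k) ((1 + z) ^ (n + a) * (1 - t * z) ^ (-(n + a + b + 1))) := by
  refine ⟨fun k => ∑ m ∈ Finset.range (k + 1), poch (n + a + b + 1) m / (m.factorial : ℂ) * t ^ m *
    (poch (n + a - (k - m : ℕ) + 1) (k - m) / ((k - m).factorial : ℂ)), ?_, fun z hz => ?_⟩
  · refine Finset.sum_congr rfl fun m hm => ?_
    rw [Nat.cast_sub (Nat.lt_succ_iff.1 (Finset.mem_range.1 hm)),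
      show (n : ℂ) + a - (n - m) + 1 = a + m + 1 by ring]
    ring
  · have h1 := hasSum_one_add_cpow (n + a) hz
    have h2 := hasSum_one_sub_cpow_neg (n + a + b + 1) t (z := z) (by
      rw [norm_mul]; exact (mul_le_of_le_one_left (norm_nonneg _) ht).trans_lt hz)
    have h3 := summable_norm_sum_mul_range_of_summable_norm h2.summable.norm h1.summable.norm
    have h4 := h3.of_norm.hasSum
    rw [← tsum_mul_tsum_eq_tsum_sum_range_of_summable_norm h2.summable.norm h1.summable.norm,
      h1.tsum_eq, h2.tsum_eq, mul_comm] at h4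
    refine (congrArg (HasSum · _) (funext fun k => ?_)).mpr h4
    rw [Finset.sum_mul]
    refine Finset.sum_congr rfl fun m hm => ?_
    have : z ^ k = z ^ m * z ^ (k - m) := by
      rw [← pow_add]; congr 1; have := Finset.mem_range.1 hm; omega
    rw [this]; ring

/-! ### Principal branches on the unit disc -/

/-- The imaginary part is `2 Im ρ (Re ρ - x)`. It vanishes only for real `ρ`, where the value is `(ρ
- x)² + 1 - x² > 0`, or for `Re ρ = x`, where the real part is `1 - |ρ|² > 0`. -/
theorem one_add_sq_sub_mem_slitPlane {ρ : ℂ} {x : ℝ} (hρ : ‖ρ‖ < 1) (hx : x ∈ Icc (-1 : ℝ) 1) :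
    1 + ρ ^ 2 - 2 * ρ * x ∈ Complex.slitPlane := by
  have hn : ρ.re ^ 2 + ρ.im ^ 2 < 1 := by
    have h1 := Complex.sq_norm ρ
    have h2 : ‖ρ‖ ^ 2 < 1 := by nlinarith [norm_nonneg ρ]
    rw [Complex.normSq_apply] at h1; nlinarith
  have hre : (1 + ρ ^ 2 - 2 * ρ * x).re = 1 + ρ.re ^ 2 - ρ.im ^ 2 - 2 * ρ.re * x := by
    simp [pow_two]; ring
  have him : (1 + ρ ^ 2 - 2 * ρ * x).im = 2 * ρ.im * (ρ.re - x) := by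
    simp [pow_two]; ring
  rw [Complex.mem_slitPlane_iff, hre, him]
  by_cases h0 : ρ.im = 0
  · left
    have h1 : |ρ.re| < 1 := by rw [← sq_lt_one_iff_abs_lt_one]; nlinarith
    rw [abs_lt] at h1
    rw [h0]
    nlinarith [sq_nonneg (ρ.re - x), hx.1, hx.2, mul_nonneg (sub_nonneg.2 hx.2)
      (by linarith [hx.1] : (0 : ℝ) ≤ 1 + x)]
  · by_cases h2 : ρ.re = x
    · left; subst h2; nlinarith
    · right; exact mul_ne_zero (mul_ne_zero two_ne_zero h0) (sub_ne_zero.2 h2)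

theorem re_cpow_half_pos {w : ℂ} (hw : w ∈ Complex.slitPlane) : 0 < (w ^ (1 / 2 : ℂ)).re := by
  have h0 := Complex.slitPlane_ne_zero hw
  have h1 := Complex.slitPlane_arg_ne_pi hw
  have h2 := Complex.arg_le_pi w
  have h3 := Complex.neg_pi_lt_arg w
  have h4 := lt_of_le_of_ne h2 h1
  rw [Complex.cpow_def_of_ne_zero h0, Complex.exp_re]
  refine mul_pos (Real.exp_pos _) (Real.cos_pos_of_mem_Ioo ?_)
  have : (Complex.log w * (1 / 2)).im = w.arg / 2 := by
    rw [show (1 / 2 : ℂ) = ((1 / 2 : ℝ) : ℂ) by norm_num, Complex.im_mul_ofReal, Complex.log_im]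
    ring
  rw [this]
  constructor <;> linarith

theorem genR_sq (ρ x : ℂ) : genR ρ x ^ 2 = 1 + ρ ^ 2 - 2 * ρ * x := by
  rw [genR, ← Complex.cpow_mul_nat]; simp

theorem abs_re_lt_one {ρ : ℂ} (hρ : ‖ρ‖ < 1) : -1 < ρ.re ∧ ρ.re < 1 :=
  abs_lt.1 ((Complex.abs_re_le_norm ρ).trans_lt hρ)

theorem genR_re_pos {ρ : ℂ} {x : ℝ} (hρ : ‖ρ‖ < 1) (hx : x ∈ Icc (-1 : ℝ) 1) :
    0 < (genR ρ x).re :=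
  re_cpow_half_pos (one_add_sq_sub_mem_slitPlane hρ hx)

theorem ne_zero_of_re_pos {z : ℂ} (h : 0 < z.re) : z ≠ 0 := by
  rintro rfl; simp at h

theorem one_add_genR_sub_re_pos {ρ : ℂ} {x : ℝ} (hρ : ‖ρ‖ < 1) (hx : x ∈ Icc (-1 : ℝ) 1) :
    0 < (1 + genR ρ x - ρ).re := by
  have := genR_re_pos hρ hx
  have := abs_re_lt_one hρ
  simp only [Complex.add_re, Complex.sub_re, Complex.one_re]; linarith

theorem one_add_genR_add_re_pos {ρ : ℂ} {x : ℝ} (hρ : ‖ρ‖ < 1) (hx : x ∈ Icc (-1 : ℝ) 1) :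
    0 < (1 + genR ρ x + ρ).re := by
  have := genR_re_pos hρ hx
  have := abs_re_lt_one hρ
  simp only [Complex.add_re, Complex.one_re]; linarith

theorem differentiableAt_genR {ρ : ℂ} {x : ℝ} (hρ : ‖ρ‖ < 1) (hx : x ∈ Icc (-1 : ℝ) 1) :
    DifferentiableAt ℂ (fun ρ => genR ρ x) ρ := by
  unfold genR
  exact DifferentiableAt.cpow_const (by fun_prop) (one_add_sq_sub_mem_slitPlane hρ hx)

theorem differentiableOn_jacobiGen (α β : ℂ) {x : ℝ} (hx : x ∈ Icc (-1 : ℝ) 1) :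
    DifferentiableOn ℂ (fun ρ => jacobiGen α β ρ x) (Metric.ball 0 1) := by
  intro ρ hρ
  rw [mem_ball_zero_iff] at hρ
  refine DifferentiableAt.differentiableWithinAt ?_
  have hR := differentiableAt_genR hρ hx
  have h1 := one_add_genR_sub_re_pos hρ hx
  have h2 := one_add_genR_add_re_pos hρ hx
  unfold jacobiGen
  refine DifferentiableAt.div (by fun_prop) (DifferentiableAt.mul (hR.mul
    (DifferentiableAt.cpow_const (by fun_prop) (Or.inl h1)))
    (DifferentiableAt.cpow_const (by fun_prop) (Or.inl h2))) ?_
  refine mul_ne_zero (mul_ne_zero (ne_zero_of_re_pos (genR_re_pos hρ hx)) ?_) ?_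
  · simp [Complex.cpow_eq_zero_iff, ne_zero_of_re_pos h1]
  · simp [Complex.cpow_eq_zero_iff, ne_zero_of_re_pos h2]

/-- Both arguments lie in `(-π/2, π/2)`, so their difference stays in the principal range. -/
theorem log_div_of_re_pos {a b : ℂ} (ha : 0 < a.re) (hb : 0 < b.re) :
    Complex.log (b / a) = Complex.log b - Complex.log a := by
  have h1 := abs_lt.1 (Complex.abs_arg_lt_pi_div_two_iff.2 (Or.inl ha))
  have h2 := abs_lt.1 (Complex.abs_arg_lt_pi_div_two_iff.2 (Or.inl hb))
  have h3 : a.arg ≠ Real.pi := by linarith [Real.pi_pos]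
  rw [div_eq_mul_inv, (Complex.log_mul_eq_add_log_iff (ne_zero_of_re_pos hb)
    (inv_ne_zero (ne_zero_of_re_pos ha))).2, Complex.log_inv _ h3, sub_eq_add_neg]
  rw [Complex.arg_inv, if_neg h3]
  constructor <;> linarith

theorem cpow_div_mul_cpow {a b : ℂ} (ha : 0 < a.re) (hb : 0 < b.re) (α β : ℂ) :
    (b / a) ^ α * (b / 2) ^ (-(α + β)) = 2 ^ (α + β) / (a ^ α * b ^ β) := by
  have ha0 := ne_zero_of_re_pos ha
  have hb0 := ne_zero_of_re_pos hb
  have h2 : (0 : ℝ) < (2 : ℂ).re := by simp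
  rw [Complex.cpow_def_of_ne_zero (div_ne_zero hb0 ha0),
    Complex.cpow_def_of_ne_zero (div_ne_zero hb0 two_ne_zero),
    Complex.cpow_def_of_ne_zero two_ne_zero, Complex.cpow_def_of_ne_zero ha0,
    Complex.cpow_def_of_ne_zero hb0, log_div_of_re_pos ha hb, log_div_of_re_pos h2 hb,
    ← Complex.exp_add, ← Complex.exp_add, ← Complex.exp_sub]
  congr 1; ring

/-! ### The generating function by Lagrange inversion -/

theorem half_le_re_one_sub_mul {t z : ℂ} (ht : ‖t‖ ≤ 1) (hz : ‖z‖ ≤ 1 / 2) : 1 / 2 ≤ (1 - t * z).re := by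
  have h1 : ‖t * z‖ ≤ 1 / 2 := by
    rw [norm_mul]; exact (mul_le_of_le_one_left (norm_nonneg _) ht).trans hz
  have := (Complex.re_le_norm (t * z)).trans h1
  simp only [Complex.sub_re, Complex.one_re]; linarith

theorem one_add_re_pos {z : ℂ} (hz : ‖z‖ ≤ 1 / 2) : 0 < (1 + z).re := by
  have := abs_le.1 ((Complex.abs_re_le_norm z).trans hz)
  simp only [Complex.add_re, Complex.one_re]; linarith

/-- The Lagrange inversion series for `z = ρ (1 + z) / (1 - t z)`, in terms of the root `w` and
the square root `R` of the discriminant. -/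
theorem hasSum_jacobiPoly_root (a b t ρ R w : ℂ) (ht : ‖t‖ ≤ 1) (hρ : ‖ρ‖ ≤ 1 / 12)
    (hw : ‖w‖ ≤ 1 / 8) (hR : 3 / 4 ≤ ‖R‖) (h1 : R + 2 * t * w = 1 - ρ)
    (h2 : R * w + t * w ^ 2 = ρ) :
    HasSum (fun n => jacobiPoly a b n t * ρ ^ n)
      ((1 + w) ^ a * (1 - t * w) ^ (-(a + b)) / R) := by
  set f : ℂ → ℂ := fun z => (1 + z) ^ a * (1 - t * z) ^ (-(a + b + 1)) with hf
  set φ : ℂ → ℂ := fun z => (1 + z) / (1 - t * z) with hφ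
  have p1 : ∀ z ∈ Metric.closedBall (0 : ℂ) (1 / 2), 0 < (1 + z).re := fun z hz =>
    one_add_re_pos (by simpa using hz)
  have p2' : ∀ z ∈ Metric.closedBall (0 : ℂ) (1 / 2), 1 / 2 ≤ (1 - t * z).re := fun z hz =>
    half_le_re_one_sub_mul ht (by simpa using hz)
  have p2 : ∀ z ∈ Metric.closedBall (0 : ℂ) (1 / 2), 0 < (1 - t * z).re := fun z hz =>
    lt_of_lt_of_le (by norm_num) (p2' z hz)
  -- Excludes the other root of the quadratic from the disc: `|t (z - w)| ≤ 1/2 + 1/8 < 3/4 ≤ |R|`.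
  have p3 : ∀ z ∈ Metric.closedBall (0 : ℂ) (1 / 2), R - t * (z - w) ≠ 0 := fun z hz h0 => by
    have e : ‖t * (z - w)‖ ≤ 5 / 8 := by
      rw [norm_mul]
      refine (mul_le_of_le_one_left (norm_nonneg _) ht).trans ((norm_sub_le _ _).trans ?_)
      have : ‖z‖ ≤ 1 / 2 := by simpa using hz
      linarith
    rw [← sub_eq_zero.1 h0] at e; linarith
  have hfd : ∀ z ∈ Metric.closedBall (0 : ℂ) (1 / 2), DifferentiableAt ℂ f z := fun z hz =>
    (DifferentiableAt.cpow_const (by fun_prop) (Or.inl (p1 z hz))).mul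
      (DifferentiableAt.cpow_const (by fun_prop) (Or.inl (p2 z hz)))
  have hφd : ∀ z ∈ Metric.closedBall (0 : ℂ) (1 / 2), DifferentiableAt ℂ φ z := fun z hz =>
    DifferentiableAt.div (by fun_prop) (by fun_prop) (ne_zero_of_re_pos (p2 z hz))
  have hsub : Metric.sphere (0 : ℂ) (1 / 2) ⊆ Metric.closedBall 0 (1 / 2) :=
    Metric.sphere_subset_closedBall
  -- On `|z| = 1/2` one has `|φ| ≤ (3/2) / (1/2) = 3`, so `|ρ φ / z| ≤ 1/2` when `|ρ| ≤ 1/12`.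
  have key := hasSum_circleIntegral_geometric (f := f) (φ := φ) (r := 1 / 2) (q := 1 / 2) (ρ := ρ)
    (by norm_num) (by norm_num)
    (fun z hz => (hfd z (hsub hz)).continuousAt.continuousWithinAt)
    (fun z hz => (hφd z (hsub hz)).continuousAt.continuousWithinAt) (fun z hz => by
      have hz' : ‖z‖ = 1 / 2 := by simpa using hz
      have e1 : ‖1 + z‖ ≤ 3 / 2 := (norm_add_le _ _).trans (by rw [hz']; norm_num)
      have e2 : 1 / 2 ≤ ‖1 - t * z‖ := (p2' z (hsub hz)).trans (Complex.re_le_norm _)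
      have e3 : ‖1 + z‖ / ‖1 - t * z‖ ≤ 3 := by
        rw [div_le_iff₀ (by linarith)]; linarith
      rw [norm_div, norm_mul, hz', norm_div, div_le_iff₀ (by norm_num)]
      calc ‖ρ‖ * (‖1 + z‖ / ‖1 - t * z‖) ≤ 1 / 12 * 3 := by gcongr
        _ = 1 / 2 * (1 / 2) := by norm_num)
  have e1 (n : ℕ) : (∮ z in C(0, 1 / 2), f z * φ z ^ n / z ^ (n + 1)) =
      2 * Real.pi * Complex.I * jacobiPoly a b n t := by
    obtain ⟨c, hc, hc'⟩ := jacobiPoly_hasSum a b t ht n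
    have := circleIntegral_div_pow_of_hasSum (s := 1 / 2) (r := 1) (by norm_num)
      (by rw [← NNReal.coe_lt_coe]; norm_num) (fun z hz => hc' z (by simpa using hz)) n
    rw [hc] at this
    rw [← this]
    push_cast
    refine circleIntegral.integral_congr (by norm_num) fun z hz => ?_
    have q1 := ne_zero_of_re_pos (p1 z (hsub hz))
    have q2 := ne_zero_of_re_pos (p2 z (hsub hz))
    simp only [hf, hφ]
    rw [Complex.cpow_add _ _ q1, Complex.cpow_natCast,
      show -((n : ℂ) + a + b + 1) = -(n : ℂ) + -(a + b + 1) by ring, Complex.cpow_add _ _ q2,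
      Complex.cpow_neg _ (n : ℂ), Complex.cpow_natCast, div_pow]
    congr 1; field_simp
  set g : ℂ → ℂ := fun z => f z * (1 - t * z) / (R - t * (z - w)) with hg
  have e2 : (∮ z in C(0, 1 / 2), f z / (z - ρ * φ z)) = 2 * Real.pi * Complex.I * g w := by
    have hgd : ∀ z ∈ Metric.closedBall (0 : ℂ) (1 / 2), DifferentiableAt ℂ g z := fun z hz =>
      ((hfd z hz).mul (by fun_prop)).div (by fun_prop) (p3 z hz)
    have hwm : w ∈ Metric.ball (0 : ℂ) (1 / 2) := by
      rw [mem_ball_zero_iff]; linarith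
    have := Complex.circleIntegral_sub_inv_smul_of_differentiable_on_off_countable
      (f := g) countable_empty hwm
      (fun z hz => (hgd z hz).continuousAt.continuousWithinAt)
      (fun z hz => hgd z (Metric.ball_subset_closedBall hz.1))
    rw [smul_eq_mul] at this
    rw [← this]
    refine circleIntegral.integral_congr (by norm_num) fun z hz => ?_
    have q2 := ne_zero_of_re_pos (p2 z (hsub hz))
    have q3 := p3 z (hsub hz)
    have q4 : z - w ≠ 0 := fun h0 => by
      have hz' : ‖z‖ = 1 / 2 := by simpa using hz
      rw [sub_eq_zero.1 h0] at hz'; linarith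
    -- Factors `z (1 - t z) - ρ (1 + z)` at its root `w`; this form needs no division by `t`, so `t
    -- = 0` is allowed.
    have q5 : z - ρ * φ z = (z - w) * (R - t * (z - w)) / (1 - t * z) := by
      have q6 : φ z * (1 - t * z) = 1 + z := div_mul_cancel₀ _ q2
      rw [eq_div_iff q2]
      linear_combination (-ρ) * q6 - z * h1 + h2
    simp only [q5, hg, smul_eq_mul]
    field_simp
  simp only [e1, e2] at key
  have h3 := key.mul_left (2 * Real.pi * Complex.I)⁻¹
  have hwm : w ∈ Metric.closedBall (0 : ℂ) (1 / 2) := by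
    rw [mem_closedBall_zero_iff]; linarith
  have q2 := ne_zero_of_re_pos (p2 w hwm)
  have e3 : g w = (1 + w) ^ a * (1 - t * w) ^ (-(a + b)) / R := by
    simp only [hg, hf, sub_self, mul_zero, sub_zero]
    rw [show -(a + b) = -(a + b + 1) + 1 by ring, Complex.cpow_add _ _ q2, Complex.cpow_one]
    ring
  simp only [mul_assoc (2 * Real.pi * Complex.I), inv_mul_cancel_left₀ Complex.two_pi_I_ne_zero,
    e3] at h3
  exact h3

theorem hasSum_jacobiPoly (α β : ℂ) {x : ℝ} (hx : x ∈ Icc (-1 : ℝ) 1) {ρ : ℂ} (hρ : ‖ρ‖ < 1) :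
    HasSum (fun n => jacobiPoly α β n ((x - 1) / 2) * ρ ^ n) (jacobiGen α β ρ x) := by
  refine hasSum_of_differentiableOn_of_hasSum (f := fun ρ => jacobiGen α β ρ x)
    (differentiableOn_jacobiGen α β hx) ?_ hρ
  have ht : ‖((x : ℂ) - 1) / 2‖ ≤ 1 := by
    rw [show ((x : ℂ) - 1) / 2 = (((x - 1) / 2 : ℝ) : ℂ) by push_cast; ring, Complex.norm_real,
      Real.norm_eq_abs, abs_le]
    constructor <;> linarith [hx.1, hx.2]
  have hR0 : genR 0 x = 1 := by simp [genR]
  have hRc : ContinuousAt (fun ρ => genR ρ x) 0 := (differentiableAt_genR (by simp) hx).continuousAt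
  -- The root vanishing at `ρ = 0`, rationalised so that it also makes sense for `x = 1`.
  have hwc : ContinuousAt (fun ρ => 2 * ρ / (1 + genR ρ x - ρ)) 0 :=
    ContinuousAt.div (by fun_prop) (by fun_prop) (by rw [hR0]; norm_num)
  have ev1 : ∀ᶠ ρ in 𝓝 (0 : ℂ), 3 / 4 < ‖genR ρ x‖ :=
    hRc.norm.eventually_const_lt (by norm_num [hR0])
  have ev2 : ∀ᶠ ρ in 𝓝 (0 : ℂ), ‖2 * ρ / (1 + genR ρ x - ρ)‖ < 1 / 8 :=
    hwc.norm.eventually_lt_const (by simp)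
  have ev3 : ∀ᶠ ρ in 𝓝 (0 : ℂ), ‖ρ‖ < 1 / 12 :=
    continuous_norm.continuousAt.eventually_lt_const (by simp)
  filter_upwards [ev1, ev2, ev3] with ρ hR hw hρ
  have hρ1 : ‖ρ‖ < 1 := by linarith
  have ha := one_add_genR_sub_re_pos hρ1 hx
  have hb := one_add_genR_add_re_pos hρ1 hx
  have ha0 := ne_zero_of_re_pos ha
  have hsq := genR_sq ρ x
  have h1 : genR ρ x + 2 * ((x - 1) / 2) * (2 * ρ / (1 + genR ρ x - ρ)) = 1 - ρ := by
    field_simp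
    linear_combination hsq
  have h2 : genR ρ x * (2 * ρ / (1 + genR ρ x - ρ)) +
      (x - 1) / 2 * (2 * ρ / (1 + genR ρ x - ρ)) ^ 2 = ρ := by
    field_simp
    linear_combination ρ * hsq
  have := hasSum_jacobiPoly_root α β _ ρ _ _ ht hρ.le hw.le hR.le h1 h2
  convert this using 1
  have e1 : 1 + 2 * ρ / (1 + genR ρ x - ρ) = (1 + genR ρ x + ρ) / (1 + genR ρ x - ρ) := by
    field_simp; ring
  have e2 : 1 - (x - 1) / 2 * (2 * ρ / (1 + genR ρ x - ρ)) = (1 + genR ρ x + ρ) / 2 := by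
    linear_combination (-1 / 2) * h1
  rw [e1, e2, cpow_div_mul_cpow ha hb, jacobiGen, div_div]
  congr 1; ring

/-! ### Reflection and the change of first parameter -/

theorem jacobiGen_reflect (α β ρ x : ℂ) : jacobiGen β α (-ρ) (-x) = jacobiGen α β ρ x := by
  have : genR (-ρ) (-x) = genR ρ x := by simp [genR]
  simp only [jacobiGen, this]
  rw [add_comm β α, sub_neg_eq_add, ← sub_eq_add_neg]
  congr 1; ring

theorem jacobiPoly_reflect (α β : ℂ) {x : ℝ} (hx : x ∈ Icc (-1 : ℝ) 1) (n : ℕ) :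
    jacobiPoly α β n ((x - 1) / 2) = (-1) ^ n * jacobiPoly β α n ((-x - 1) / 2) := by
  refine congrFun (coeff_unique_of_hasSum (fun z hz => hasSum_jacobiPoly α β hx hz)
    (d := fun n => (-1) ^ n * jacobiPoly β α n ((-x - 1) / 2)) fun z hz => ?_) n
  have := hasSum_jacobiPoly β α (x := -x) ⟨by linarith [hx.2], by linarith [hx.1]⟩ (ρ := -z)
    (by simpa using hz)
  push_cast at this
  rw [jacobiGen_reflect] at this
  refine this.congr_fun fun n => ?_
  rw [neg_pow]; ring

theorem jacobiPoly_expansion (α β γ : ℂ) (hc : ∀ i : ℕ, γ + β + 1 + i ≠ 0) {x : ℝ}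
    (hx : x ∈ Icc (-1 : ℝ) 1) (n : ℕ) :
    jacobiPoly α β n ((x - 1) / 2) = ∑ k ∈ Finset.range (n + 1),
      connCoeff α β γ k (n - k) * jacobiPoly γ β k ((x - 1) / 2) := by
  rw [jacobiPoly_reflect α β hx, jacobiPoly_connection α β γ hc]
  exact Finset.sum_congr rfl fun k _ => by rw [jacobiPoly_reflect γ β hx]

/-! ### Matching the hypergeometric definitions -/

theorem poch_two_mul (z : ℂ) (k : ℕ) :
    poch (z / 2) k * poch ((z + 1) / 2) k = poch z (2 * k) / 4 ^ k := by
  induction k with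
  | zero => simp [poch_zero]
  | succ k ih =>
    rw [poch_succ, poch_succ, show 2 * (k + 1) = 2 * k + 1 + 1 by ring, poch_succ, poch_succ]
    rw [eq_div_iff (by simp)] at ih ⊢
    rw [← ih]; push_cast; ring

theorem jacobiP_eq_jacobiPoly (a b : ℂ) (ha : ∀ i : ℕ, a + 1 + i ≠ 0) (n : ℕ) (x : ℂ) :
    jacobiP a b n x = jacobiPoly a b n ((x - 1) / 2) := by
  rw [jacobiP, ordinaryHypergeometric_eq_tsum]
  beta_reduce
  rw [tsum_eq_sum (s := Finset.range (n + 1)), Finset.mul_sum]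
  · refine Finset.sum_congr rfl fun m hm => ?_
    obtain ⟨l, rfl⟩ := Nat.exists_eq_add_of_le (Nat.lt_succ_iff.1 (Finset.mem_range.1 hm))
    have h1 : poch (-((m + l : ℕ) : ℂ)) m = (-1) ^ m * poch ((l : ℂ) + 1) m := by
      rw [poch_neg]; congr 2; push_cast; ring
    have h2 : (l.factorial : ℂ) * poch ((l : ℂ) + 1) m = ((m + l).factorial : ℂ) := by
      rw [add_comm m l]; exact factorial_mul_ascPochhammer ℂ l m
    have h3 : poch (a + 1) m ≠ 0 := poch_ne_zero _ ha
    have f1 : (l.factorial : ℂ) ≠ 0 := by exact_mod_cast l.factorial_ne_zero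
    have f2 : (m.factorial : ℂ) ≠ 0 := by exact_mod_cast m.factorial_ne_zero
    have f3 : ((m + l).factorial : ℂ) ≠ 0 := by exact_mod_cast (m + l).factorial_ne_zero
    have h4 : poch ((l : ℂ) + 1) m = ((m + l).factorial : ℂ) / l.factorial := by
      rw [eq_div_iff f1, ← h2]; ring
    change poch (a + 1) (m + l) / _ * (((m.factorial : ℂ)⁻¹ * poch (-((m + l : ℕ) : ℂ)) m *
      poch ((m + l : ℕ) + a + b + 1) m * (poch (a + 1) m)⁻¹) • _) = _
    rw [h1, h4, poch_add (a + 1) m l, Nat.add_sub_cancel_left, smul_eq_mul,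
      show (x - 1) / 2 = (-1) * ((1 - x) / 2) by ring, mul_pow,
      show a + 1 + (m : ℂ) = a + m + 1 by ring]
    field_simp
  · intro m hm
    rw [ascPochhammer_eval_neg_coe_nat_of_lt (by simpa using hm)]
    simp

/-- By the duplication formula, the denominators `(α+β+1)_k` and `(α+β+k+1)_j` cancel against the
numerator, so the right-hand side has no poles in `α`. -/
theorem expansionCoeff_eq_tsum (α β γ ρ : ℂ) (hc : ∀ i : ℕ, γ + β + 1 + i ≠ 0)
    (hd : ∀ i : ℕ, α + β + 1 + i ≠ 0) (k : ℕ) :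
    expansionCoeff α β γ ρ k = ∑' j : ℕ, connCoeff α β γ k j * ρ ^ j := by
  rw [expansionCoeff, hyperPFQ, ← tsum_mul_left]
  refine tsum_congr fun j => ?_
  simp only [List.map_cons, List.map_nil, List.prod_cons, List.prod_nil, mul_one]
  rw [connCoeff]
  have hcp (i n : ℕ) : poch (γ + β + 1 + i) n ≠ 0 := poch_ne_zero _ fun q => by
    have := hc (i + q); push_cast at this; rwa [← add_assoc] at this
  have hdp (i n : ℕ) : poch (α + β + 1 + i) n ≠ 0 := poch_ne_zero _ fun q => by
    have := hd (i + q); push_cast at this; rwa [← add_assoc] at this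
  have d1 : poch ((α + β + 1) / 2) k * poch ((α + β + 2) / 2) k =
      poch (α + β + 1) k * poch (α + β + 1 + k) k / 4 ^ k := by
    rw [← poch_add, ← two_mul, ← poch_two_mul]; congr 3; ring
  have d2 : poch (α + β + 1 + k) k * poch (α + β + 2 * k + 1) j =
      poch (α + β + k + 1) j * poch (α + β + k + j + 1) k := by
    have h1 := poch_add (α + β + 1 + k) k j
    rw [add_comm k j, poch_add] at h1
    rw [show α + β + 2 * k + 1 = α + β + 1 + k + k by ring, ← h1]
    congr 2 <;> ring
  have c1 : (γ + β + 1) * (poch ((γ + β + 2) / 2) k * poch ((γ + β + 3) / 2) k) =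
      poch (γ + β + 1) k * poch (γ + β + k + 1) k * (2 * k + γ + β + 1) / 4 ^ k := by
    have h1 := poch_two_mul (γ + β + 2) k
    rw [show γ + β + 2 + 1 = γ + β + 3 by ring] at h1
    have h2 := poch_succ_left (γ + β + 1) (2 * k)
    rw [poch_succ, two_mul, poch_add, show γ + β + 1 + 1 = γ + β + 2 by ring] at h2
    rw [h1, ← mul_div_assoc, two_mul k, ← h2]
    push_cast
    rw [show γ + β + 1 + (k : ℂ) = γ + β + k + 1 by ring]
    ring
  have n1 := hc 0
  have n2 := hcp 0 k
  have n3 := hcp k k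
  have n4 := hcp (2 * k + 1) j
  have n5 := hc (2 * k)
  have n6 := hdp 0 k
  have n7 := hdp k j
  have n8 := hdp k k
  rw [show γ + β + 1 + (k : ℂ) = γ + β + k + 1 by ring] at n3
  rw [show γ + β + 1 + ((2 * k + 1 : ℕ) : ℂ) = γ + β + 2 * k + 2 by push_cast; ring] at n4
  rw [show γ + β + 1 + ((2 * k : ℕ) : ℂ) = 2 * k + γ + β + 1 by push_cast; ring] at n5
  rw [show α + β + 1 + (k : ℂ) = α + β + k + 1 by ring] at n7
  simp only [Nat.cast_zero, add_zero] at n1 n2 n6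
  have f : (j.factorial : ℂ) ≠ 0 := by exact_mod_cast j.factorial_ne_zero
  have c2 : (2 * (k : ℂ) + γ + β + 1) * poch (γ + β + 1) k /
      ((γ + β + 1) * (poch ((γ + β + 2) / 2) k * poch ((γ + β + 3) / 2) k)) =
      4 ^ k / poch (γ + β + k + 1) k := by
    rw [c1]; field_simp
  have d3 : poch ((α + β + 1) / 2) k * poch ((α + β + 2) / 2) k / poch (α + β + 1) k =
      poch (α + β + 1 + k) k / 4 ^ k := by
    rw [d1]; field_simp
  calc _ = ((2 * (k : ℂ) + γ + β + 1) * poch (γ + β + 1) k /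
      ((γ + β + 1) * (poch ((γ + β + 2) / 2) k * poch ((γ + β + 3) / 2) k))) *
      (poch ((α + β + 1) / 2) k * poch ((α + β + 2) / 2) k / poch (α + β + 1) k) *
      (poch (β + k + 1) j * poch (α - γ) j * (poch (α + β + 2 * k + 1) j /
        (poch (α + β + k + 1) j * poch (γ + β + 2 * k + 2) j)) * (ρ ^ j / j.factorial)) := by
        simp only [div_eq_mul_inv, mul_inv]; ring
    _ = (poch (α + β + 1 + k) k * poch (α + β + 2 * k + 1) j) *
      (poch (β + k + 1) j * poch (α - γ) j * ρ ^ j / (poch (γ + β + k + 1) k *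
        (poch (α + β + k + 1) j * poch (γ + β + 2 * k + 2) j) * j.factorial)) := by
        rw [c2, d3]; field_simp
    _ = _ := by rw [d2]; field_simp

/-! ### Growth of the connection coefficients -/

theorem norm_ofReal_add_natCast {u : ℝ} (hu : 0 ≤ u) (n : ℕ) : ‖(u : ℂ) + n‖ = u + n := by
  rw [show (u : ℂ) + n = ((u + n : ℝ) : ℂ) by push_cast; rfl, Complex.norm_real,
    Real.norm_of_nonneg (by positivity)]

theorem norm_poch_le_of_norm_le {z : ℂ} {u : ℝ} (h : ‖z‖ ≤ u) (n : ℕ) :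
    ‖poch z n‖ ≤ ‖poch u n‖ := by
  induction n with
  | zero => simp [poch_zero]
  | succ n ih =>
    rw [poch_succ, poch_succ, norm_mul, norm_mul,
      norm_ofReal_add_natCast ((norm_nonneg z).trans h)]
    have : ‖z + n‖ ≤ u + n := (norm_add_le _ _).trans (by simpa using h)
    gcongr

theorem norm_poch_le_of_le_re {z : ℂ} {v : ℝ} (hv : 0 ≤ v) (h : v ≤ z.re) (n : ℕ) :
    ‖poch v n‖ ≤ ‖poch z n‖ := by
  induction n with
  | zero => simp [poch_zero]
  | succ n ih =>
    rw [poch_succ, poch_succ, norm_mul, norm_mul, norm_ofReal_add_natCast hv]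
    have : v + n ≤ ‖z + n‖ := le_trans (by simpa using h) (Complex.re_le_norm _)
    gcongr

theorem pow_le_norm_poch {δ v : ℝ} (hδ : 0 ≤ δ) (h : δ ≤ v) (p : ℕ) : δ ^ p ≤ ‖poch v p‖ := by
  induction p with
  | zero => simp [poch_zero]
  | succ p ih =>
    rw [poch_succ, norm_mul, norm_ofReal_add_natCast (hδ.trans h), pow_succ]
    have : δ ≤ v + p := h.trans (by simp)
    gcongr

theorem norm_poch_le_pow {v : ℝ} (hv : 0 ≤ v) (p : ℕ) : ‖poch v p‖ ≤ (v + p) ^ p := by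
  have aux (q : ℕ) (hq : q ≤ p) : ‖poch v q‖ ≤ (v + p) ^ q := by
    induction q with
    | zero => simp [poch_zero]
    | succ q ih =>
      rw [poch_succ, norm_mul, norm_ofReal_add_natCast hv, pow_succ]
      have h1 := ih (Nat.le_of_succ_le hq)
      have : (q : ℝ) ≤ p := by exact_mod_cast Nat.le_of_succ_le hq
      gcongr
  exact aux p le_rfl

/-- From `(v)_p (v+p)_n = (v)_n (v+n)_p`: shifting the argument by `p` costs only a power of `n`. -/
theorem norm_poch_add_le {δ v : ℝ} (hδ : 0 < δ) (h : δ ≤ v) (p n : ℕ) :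
    ‖poch ((v + p : ℝ) : ℂ) n‖ ≤ ‖poch v n‖ * (v + n + p) ^ p / δ ^ p := by
  have hv := hδ.le.trans h
  have h1 := poch_add v p n
  rw [add_comm p n, poch_add] at h1
  have h2 := congrArg norm h1
  rw [norm_mul, norm_mul] at h2
  have h3 := norm_poch_le_pow (v := v + n) (by positivity) p
  have h4 := pow_le_norm_poch hδ.le h p
  push_cast at h3 ⊢
  rw [le_div_iff₀ (by positivity)]
  calc ‖poch (v + p) n‖ * δ ^ p ≤ ‖poch (v + p) n‖ * ‖poch v p‖ := by gcongr
    _ = ‖poch v n‖ * ‖poch (v + n) p‖ := by rw [h2]; ring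
    _ ≤ _ := by gcongr

theorem norm_connCoeff_le {β γ : ℝ} (hβ : -1 < β) (hγ : -1 < γ) (M : ℝ) :
    ∃ K : ℝ, ∃ p : ℕ, 0 ≤ K ∧ ∀ α : ℂ, ‖α‖ ≤ M → ∀ k j : ℕ,
      ‖connCoeff α β γ k j‖ ≤ K * (2 * (k + j : ℕ) + p + 1) ^ (2 * p) := by
  obtain ⟨p, hp⟩ := exists_nat_ge (M + |β| + |γ| + 2)
  -- A positive lower bound is taken from `γ + β + 2`, as `γ + β + 1` may be negative.
  set δ : ℝ := min (γ + β + 2) 1 with hδd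
  have hδ : 0 < δ := lt_min (by linarith) one_pos
  have hδ1 : δ ≤ 1 := min_le_right _ _
  have hδ2 : δ ≤ γ + β + 2 := min_le_left _ _
  refine ⟨1 / δ ^ p, p, by positivity, fun α hα k j => ?_⟩
  have hM : 0 ≤ M := (norm_nonneg α).trans hα
  have hβ0 := abs_nonneg β
  have hγ0 := abs_nonneg γ
  -- Truncated subtraction is intended: for `k = 0` the symbol `(γ+β+k+1)_k` is empty and needs no
  -- bound on its base. Numerator symbols merge into `(v+p)_{j+k}`, denominator symbols into
  -- `(v)_{k+j}`.
  set v : ℝ := δ + (k - 1 : ℕ) with hv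
  have hvδ : δ ≤ v := by simp [hv]
  have hv0 : 0 < v := hδ.trans_le hvδ
  have hvk : (k : ℝ) - 1 ≤ v := by
    have : (k : ℝ) ≤ (k - 1 : ℕ) + 1 := by exact_mod_cast (by omega : k ≤ k - 1 + 1)
    linarith
  have hvk' : v ≤ k + 1 := by
    have : ((k - 1 : ℕ) : ℝ) ≤ k := by exact_mod_cast (by omega : k - 1 ≤ k)
    linarith
  have b1 : ‖poch (β + k + 1) j‖ ≤ ‖poch ((v + p : ℝ) : ℂ) j‖ := by
    refine norm_poch_le_of_norm_le ((norm_add_le _ _).trans ?_) j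
    have := norm_add_le (β : ℂ) k
    rw [Complex.norm_real, Complex.norm_natCast, Real.norm_eq_abs] at this
    rw [norm_one]; linarith
  have b2 : ‖poch (α + β + k + j + 1) k‖ ≤ ‖poch ((v + p + j : ℝ) : ℂ) k‖ := by
    refine norm_poch_le_of_norm_le ?_ k
    have h1 := norm_add_le (α + β + k + j) 1
    have h2 := norm_add_le (α + β + k) (j : ℂ)
    have h3 := norm_add_le (α + β) (k : ℂ)
    have h4 := norm_add_le α (β : ℂ)
    rw [Complex.norm_real, Real.norm_eq_abs] at h4
    rw [Complex.norm_natCast] at h2 h3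
    rw [norm_one] at h1
    linarith
  have b3 : ‖poch (β + k + 1) j‖ * ‖poch (α + β + k + j + 1) k‖ ≤
      ‖poch ((v + p : ℝ) : ℂ) (j + k)‖ := by
    rw [poch_add, norm_mul]
    push_cast at b1 b2 ⊢
    gcongr
  have b4 : ‖poch (α - γ) j‖ ≤ ‖poch ((1 + p : ℝ) : ℂ) j‖ := by
    refine norm_poch_le_of_norm_le ((norm_sub_le _ _).trans ?_) j
    rw [Complex.norm_real, Real.norm_eq_abs]; linarith
  have l1 : ‖poch v k‖ ≤ ‖poch (γ + β + k + 1) k‖ := by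
    rcases k with _ | k
    · simp [poch_zero]
    · refine norm_poch_le_of_le_re hv0.le ?_ _
      simp [hv]; linarith
  have l2 : ‖poch ((v + k : ℝ) : ℂ) j‖ ≤ ‖poch (γ + β + 2 * k + 2) j‖ := by
    refine norm_poch_le_of_le_re (by positivity) ?_ _
    have : ((k - 1 : ℕ) : ℝ) ≤ k := by exact_mod_cast (by omega : k - 1 ≤ k)
    simp [hv]; linarith
  have l3 : ‖poch v (j + k)‖ ≤ ‖poch (γ + β + k + 1) k‖ * ‖poch (γ + β + 2 * k + 2) j‖ := by
    rw [add_comm j k, poch_add, norm_mul]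
    push_cast at l2
    gcongr
  have u1 := b3.trans (norm_poch_add_le hδ hvδ p (j + k))
  have u2 := b4.trans (norm_poch_add_le one_pos le_rfl p j)
  have hj : ‖poch ((1 : ℝ) : ℂ) j‖ = j.factorial := by
    rw [Complex.ofReal_one, poch, ascPochhammer_eval_one, Complex.norm_natCast]
  rw [hj, one_pow, div_one] at u2
  have hjf : (0 : ℝ) < j.factorial := by exact_mod_cast j.factorial_pos
  have hpv : 0 < ‖poch v (j + k)‖ := (pow_pos hδ _).trans_le (pow_le_norm_poch hδ.le hvδ _)
  have hD := hpv.trans_le l3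
  have w1 : v + (j + k : ℕ) + p ≤ 2 * (k + j : ℕ) + p + 1 := by
    push_cast; have : (0 : ℝ) ≤ j := by positivity
    linarith
  have w2 : 1 + (j : ℝ) + p ≤ 2 * (k + j : ℕ) + p + 1 := by
    push_cast; have : (0 : ℝ) ≤ j := by positivity
    have : (0 : ℝ) ≤ k := by positivity
    linarith
  rw [connCoeff, norm_div, norm_mul, norm_mul, norm_mul, norm_mul, Complex.norm_natCast,
    div_le_iff₀ (by positivity)]
  calc _ = (‖poch (β + k + 1) j‖ * ‖poch (α + β + k + j + 1) k‖) * ‖poch (α - γ) j‖ := by ring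
    _ ≤ (‖poch v (j + k)‖ * (v + (j + k : ℕ) + p) ^ p / δ ^ p) *
        (j.factorial * (1 + (j : ℝ) + p) ^ p) := by gcongr
    _ ≤ ((‖poch (γ + β + k + 1) k‖ * ‖poch (γ + β + 2 * k + 2) j‖) *
        (2 * (k + j : ℕ) + p + 1) ^ p / δ ^ p) *
        (j.factorial * (2 * (k + j : ℕ) + p + 1) ^ p) := by gcongr
    _ = _ := by rw [two_mul p, pow_add]; ring

theorem norm_connCoeff_mul_pow_le {β γ : ℝ} (hβ : -1 < β) (hγ : -1 < γ) (M : ℝ) {s : ℝ}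
    (hs : 0 < s) (hs1 : s < 1) :
    ∃ C : ℝ, ∀ α : ℂ, ‖α‖ ≤ M → ∀ k j : ℕ, ‖connCoeff α β γ k j‖ * s ^ (k + j) ≤ C := by
  obtain ⟨K, p, hK, h⟩ := norm_connCoeff_le hβ hγ M
  have ht := tendsto_pow_const_mul_const_pow_of_abs_lt_one (2 * p)
    (by rwa [abs_of_pos hs] : |s| < 1)
  obtain ⟨B, hB⟩ := ht.bddAbove_range
  refine ⟨K * (p + 2) ^ (2 * p) * (B / s), fun α hα k j => ?_⟩
  have h1 := hB (mem_range_self (k + j + 1))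
  beta_reduce at h1
  have h2 : ((k + j + 1 : ℕ) : ℝ) ^ (2 * p) * s ^ (k + j) ≤ B / s := by
    rw [le_div_iff₀ hs, mul_assoc, ← pow_succ]; exact h1
  have h3 : 2 * ((k + j : ℕ) : ℝ) + p + 1 ≤ (p + 2) * (k + j + 1 : ℕ) := by
    rw [Nat.cast_add_one]
    have : (0 : ℝ) ≤ p * ((k + j : ℕ) : ℝ) := by positivity
    linarith
  calc _ ≤ K * (2 * (k + j : ℕ) + p + 1) ^ (2 * p) * s ^ (k + j) := by
        have := h α hα k j
        gcongr
    _ ≤ K * ((p + 2) * (k + j + 1 : ℕ)) ^ (2 * p) * s ^ (k + j) := by gcongr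
    _ = K * (p + 2) ^ (2 * p) * ((k + j + 1 : ℕ) ^ (2 * p) * s ^ (k + j)) := by
        rw [mul_pow]; ring
    _ ≤ _ := by gcongr

theorem exists_sq_gt {q : ℝ} (hq0 : 0 ≤ q) (hq : q < 1) : ∃ s : ℝ, 0 < s ∧ s < 1 ∧ q < s * s :=
  ⟨(q + 2) / 3, by linarith, by linarith, by nlinarith⟩

/-! ### Rearranging the double series -/

theorem exists_norm_jacobiPoly_mul_pow_le (a b : ℂ) {x : ℝ} (hx : x ∈ Icc (-1 : ℝ) 1) {s : ℝ}
    (hs : 0 < s) (hs1 : s < 1) :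
    ∃ C : ℝ, ∀ k : ℕ, ‖jacobiPoly a b k ((x - 1) / 2)‖ * s ^ k ≤ C := by
  have h := hasSum_jacobiPoly a b hx (ρ := s)
    (by rwa [Complex.norm_real, Real.norm_eq_abs, abs_of_pos hs])
  obtain ⟨B, hB⟩ := h.summable.tendsto_atTop_zero.norm.bddAbove_range
  refine ⟨B, fun k => ?_⟩
  have := hB (mem_range_self k)
  beta_reduce at this
  rwa [norm_mul, norm_pow, Complex.norm_real, Real.norm_eq_abs, abs_of_pos hs] at this

theorem summable_connCoeff_mul {β γ x : ℝ} (hβ : -1 < β) (hγ : -1 < γ) (α : ℂ) {ρ : ℂ}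
    (hρ : ‖ρ‖ < 1) (hx : x ∈ Icc (-1 : ℝ) 1) :
    Summable fun q : ℕ × ℕ =>
      connCoeff α β γ q.1 q.2 * jacobiPoly γ β q.1 ((x - 1) / 2) * ρ ^ (q.1 + q.2) := by
  -- One factor `s` pays for the connection coefficient, the other for the Jacobi polynomial.
  obtain ⟨s, hs, hs1, hqs⟩ := exists_sq_gt (norm_nonneg ρ) hρ
  obtain ⟨C, hC⟩ := norm_connCoeff_mul_pow_le hβ hγ ‖α‖ hs hs1
  obtain ⟨B, hB⟩ := exists_norm_jacobiPoly_mul_pow_le γ β hx hs hs1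
  have hqs' : ‖ρ‖ < s := by nlinarith
  have g1 : Summable fun k : ℕ => (‖ρ‖ / (s * s)) ^ k :=
    summable_geometric_of_lt_one (by positivity) ((div_lt_one (by positivity)).2 hqs)
  have g2 : Summable fun j : ℕ => (‖ρ‖ / s) ^ j :=
    summable_geometric_of_lt_one (by positivity) ((div_lt_one hs).2 hqs')
  have g := (g1.mul_of_nonneg g2 (fun k => by positivity) fun j => by positivity).mul_left (C * B)
  refine Summable.of_norm_bounded g fun ⟨k, j⟩ => ?_
  have h1 := hC α le_rfl k j
  have h2 := hB k
  have hC0 : 0 ≤ C := le_trans (by positivity) h1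
  rw [norm_mul, norm_mul, norm_pow]
  calc _ = (‖connCoeff α β γ k j‖ * s ^ (k + j)) * (‖jacobiPoly γ β k ((x - 1) / 2)‖ * s ^ k) *
        ((‖ρ‖ / (s * s)) ^ k * (‖ρ‖ / s) ^ j) := by
        rw [div_pow, div_pow, mul_pow, pow_add, pow_add]; field_simp
    _ ≤ _ := by gcongr

theorem add_add_one_add_natCast_ne_zero {β γ : ℝ} (hβ : -1 < β) (hγ : -1 < γ)
    (hβγ : β + γ + 1 ≠ 0) (i : ℕ) : (γ : ℂ) + β + 1 + i ≠ 0 := by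
  rcases i with _ | i
  · intro h
    apply hβγ
    have : ((β + γ + 1 : ℝ) : ℂ) = 0 := by push_cast; simpa [add_comm (β : ℂ)] using h
    exact_mod_cast this
  · refine ne_zero_of_re_pos ?_
    have : (0 : ℝ) ≤ i := i.cast_nonneg
    simp; linarith

theorem hasSum_expansion {β γ x : ℝ} (hβ : -1 < β) (hγ : -1 < γ) (hβγ : β + γ + 1 ≠ 0) (α : ℂ)
    {ρ : ℂ} (hρ : ‖ρ‖ < 1) (hx : x ∈ Icc (-1 : ℝ) 1) :
    HasSum (fun k : ℕ => (∑' j : ℕ, connCoeff α β γ k j * ρ ^ j) * ρ ^ k * jacobiP γ β k x)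
      (jacobiGen α β ρ x) := by
  have hc := add_add_one_add_natCast_ne_zero hβ hγ hβγ
  have hγc (i : ℕ) : (γ : ℂ) + 1 + i ≠ 0 := by
    refine ne_zero_of_re_pos ?_
    have : (0 : ℝ) ≤ i := i.cast_nonneg
    simp; linarith
  have hF := summable_connCoeff_mul hβ hγ α hρ hx
  have h1 := hF.hasSum.prod_fiberwise fun k => (hF.prod_factor k).hasSum
  -- Rows of the double series give the claimed expansion; antidiagonals `k + j = n` give the
  -- generating function.
  have h2 := (Finset.HasAntidiagonal.sigmaAntidiagonalEquivProd.hasSum_iff.2 hF.hasSum).sigma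
    fun n => hasSum_fintype _
  have h3 := hasSum_jacobiPoly α β hx hρ
  have h4 := h3.unique (h2.congr_fun fun n => by
    rw [jacobiPoly_expansion α β γ hc hx]
    simp only [Function.comp_apply, Finset.HasAntidiagonal.sigmaAntidiagonalEquivProd_apply]
    rw [Finset.sum_coe_sort (Finset.HasAntidiagonal.antidiagonal n) fun q : ℕ × ℕ =>
      connCoeff α β γ q.1 q.2 * jacobiPoly γ β q.1 ((x - 1) / 2) * ρ ^ (q.1 + q.2),
      Finset.Nat.sum_antidiagonal_eq_sum_range_succ_mk, Finset.sum_mul]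
    refine Finset.sum_congr rfl fun k hk => ?_
    rw [Nat.add_sub_cancel' (Nat.lt_succ_iff.1 (Finset.mem_range.1 hk))])
  rw [h4]
  refine h1.congr_fun fun k => ?_
  rw [jacobiP_eq_jacobiPoly _ _ hγc, ← tsum_mul_right, ← tsum_mul_right]
  refine tsum_congr fun j => ?_
  rw [pow_add]; ring

/-! ### Continuity in `α` and the exceptional case -/

theorem continuous_connCoeff (β γ : ℂ) (k j : ℕ) : Continuous fun α => connCoeff α β γ k j := by
  unfold connCoeff poch
  refine Continuous.div_const ?_ _
  exact (continuous_const.mul ((Polynomial.continuous _).comp (by fun_prop))).mul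
    ((Polynomial.continuous _).comp (by fun_prop))

theorem continuous_tsum_connCoeff {β γ : ℝ} (hβ : -1 < β) (hγ : -1 < γ) {ρ : ℂ} (hρ : ‖ρ‖ < 1)
    (k : ℕ) : Continuous fun α : ℂ => ∑' j : ℕ, connCoeff α β γ k j * ρ ^ j := by
  refine continuous_iff_continuousAt.2 fun α => ?_
  obtain ⟨s, hs, hs1, hqs⟩ := exists_sq_gt (norm_nonneg ρ) hρ
  have hqs' : ‖ρ‖ < s := by nlinarith
  obtain ⟨C, hC⟩ := norm_connCoeff_mul_pow_le hβ hγ (‖α‖ + 1) hs hs1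
  have g : Summable fun j : ℕ => C / s ^ k * (‖ρ‖ / s) ^ j :=
    (summable_geometric_of_lt_one (by positivity) ((div_lt_one hs).2 hqs')).mul_left _
  have := continuousOn_tsum (f := fun j (α : ℂ) => connCoeff α β γ k j * ρ ^ j)
    (s := Metric.ball α 1)
    (fun j => ((continuous_connCoeff _ _ k j).mul continuous_const).continuousOn) g
    fun j a ha => by
      have ha' : ‖a‖ ≤ ‖α‖ + 1 := by
        have h1 := norm_add_le α (a - α)
        rw [mem_ball_iff_norm] at ha
        rw [add_sub_cancel] at h1; linarith
      have h1 := hC a ha' k j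
      rw [norm_mul, norm_pow]
      calc ‖connCoeff a β γ k j‖ * ‖ρ‖ ^ j =
          ‖connCoeff a β γ k j‖ * s ^ (k + j) / s ^ k * (‖ρ‖ / s) ^ j := by
            rw [div_pow, pow_add]; field_simp
        _ ≤ _ := by gcongr
  exact this.continuousAt (Metric.ball_mem_nhds α one_pos)

theorem eventually_add_natCast_ne_zero {z c : ℂ} (h : ∃ j : ℕ, z + c = -j) :
    ∀ᶠ a in 𝓝[≠] z, ∀ i : ℕ, a + c + i ≠ 0 := by
  obtain ⟨j, hj⟩ := h
  filter_upwards [self_mem_nhdsWithin, mem_nhdsWithin_of_mem_nhds (Metric.ball_mem_nhds z one_pos)]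
    with a ha hb i hi
  have e : a - z = ((j - i : ℤ) : ℂ) := by push_cast; linear_combination hi - hj
  rw [mem_ball_iff_norm, e, Complex.norm_intCast] at hb
  have h0 : (j - i : ℤ) = 0 := Int.abs_lt_one_iff.1 (by exact_mod_cast hb)
  rw [h0, Int.cast_zero, sub_eq_zero] at e
  exact ha e

theorem mainTheorem1 (α ρ : ℂ) (β γ x : ℝ) (hβ : -1 < β) (hγ : -1 < γ)
    (hβγ : β ∈ Ioo (-1 : ℝ) 0 → γ ∈ Ioo (-1 : ℝ) 0 → β + γ + 1 ≠ 0)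
    (hρ : ‖ρ‖ < 1) (hx : x ∈ Icc (-1 : ℝ) 1) :
    ((∀ j : ℕ, α + (β : ℂ) + 1 ≠ -(j : ℂ)) →
      HasSum (fun k : ℕ => expansionCoeff α β γ ρ k * ρ ^ k * jacobiP γ β k x)
        (jacobiGen α β ρ x)) ∧
    ((∃ j : ℕ, α + (β : ℂ) + 1 = -(j : ℂ)) →
      ∃ d : ℕ → ℂ,
        (∀ k : ℕ, Tendsto (fun a : ℂ => expansionCoeff a β γ ρ k) (𝓝[≠] α) (𝓝 (d k))) ∧
        HasSum (fun k : ℕ => d k * ρ ^ k * jacobiP γ β k x) (jacobiGen α β ρ x)) := by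
  -- With both parameters above `-1`, vanishing of `β + γ + 1` forces both into `(-1, 0)`.
  have hne : β + γ + 1 ≠ 0 := fun h =>
    hβγ ⟨hβ, by linarith⟩ ⟨hγ, by linarith⟩ h
  have hc (i : ℕ) : (γ : ℂ) + β + 1 + i ≠ 0 := add_add_one_add_natCast_ne_zero hβ hγ hne i
  have hsum := hasSum_expansion hβ hγ hne α hρ hx
  -- The limits are the pole-free sums over `j`, whose expansion holds for every `α`; nearby `a ≠ α`
  -- avoid the isolated poles.
  refine ⟨fun h => ?_, fun ⟨j, hj⟩ => ⟨_, fun k => ?_, hsum⟩⟩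
  · refine hsum.congr_fun fun k => ?_
    rw [expansionCoeff_eq_tsum α β γ ρ hc fun i hi => h i (eq_neg_of_add_eq_zero_left hi)]
  · refine (((continuous_tsum_connCoeff hβ hγ hρ k).tendsto α).mono_left
      nhdsWithin_le_nhds).congr' ?_
    filter_upwards [eventually_add_natCast_ne_zero (z := α) (c := β + 1)
      ⟨j, by rw [← add_assoc, hj]⟩] with a ha
    rw [expansionCoeff_eq_tsum a β γ ρ hc fun i => by rw [add_assoc a]; exact ha i]
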